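/- A resource allocation game consists of agents $1,\dots,n$, a finite set $\mathcal R$ of resources, for each agent $i$ a nonempty set $\mathcal A_i$ of subsets of $\mathcal R$ (its actions), and for each resource $r$ a welfare rule $w_r$ and a utility rule $u_r$ (functions of the number of users). For a joint action $a=(a_1,\dots,a_n)\in\mathcal A=\prod_i\mathcal A_i$ let $|a|_r$ be the number of agents $i$ with $r\in a_i$; the welfare is $W(a)=\sum_{r\in\bigcup_i a_i}w_r(|a|_r)$ and the utility of agent $i$ is $U_i(a)=\sum_{r\in a_i}u_r(|a|_r)$. A one-round walk starts with no agent using any resource; then agents $1,\dots,n$ move once each, in this order, each to an arbitrary best response in $\mathcal A_i$ to the current choices of the others. The one-round efficiency $\mathrm{Eff}(G)$ is the least welfare at the end of a one-round walk divided by $\max_{a\in\mathcal A}W(a)$; the price of anarchy $\mathrm{PoA}(G)$ is the least welfare of a pure Nash equilibrium divided by $\max_{a\in\mathcal A}W(a)$. Let $\mathcal W$ be the set of all submodular welfare rules, that is, all $w:\{0,1,2,\dots\}\to\mathbb R$ with $w(0)=0$, $w(j)>0$ for $j\ge1$, $w(j+1)\ge w(j)$, and $w(j+1)-w(j)$ nonincreasing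 in $j\ge 0$. A utility design $F$ assigns to each $w\in\mathcal W$ a utility rule $F(w)$ with nonnegative values. It induces the class of all games with $w_r\in\mathcal W$ and $u_r=F(w_r)$ for all $r$ and with $\max_{a}W(a)>0$; $\mathrm{Eff}(F)$ and $\mathrm{PoA}(F)$ denote the infima of $\mathrm{Eff}(G)$ and $\mathrm{PoA}(G)$ over this class. Call $F$ PoA-optimal if it maximizes $\mathrm{PoA}(F)$, and one-round-optimal if it maximizes $\mathrm{Eff}(F)$, over all utility designs; call $F$ nonincreasing if $F(w)(j+1)\le F(w)(j)$ for all $w\in\mathcal W$ and $j\ge1$. **Theorem 4.** (1) PoA-optimal designs exist, and every PoA-optimal design $F$ satisfies $\mathrm{Eff}(F)=0$ and $\mathrm{PoA}(F)=1-\frac1e$. (2) Nonincreasing one-round-optimal designs exist, and every nonincreasing one-round-optimal design $F$ satisfies $\mathrm{Eff}(F)=\frac12$ and $\mathrm{PoA}(F)=\frac12$. Moreover, every one-round-optimal design $F$, nonincreasing or not, satisfies $\mathrm{Eff}(F)=\frac12$ and $\mathrm{PoA}(F)\le\frac12$. -/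

import Mathlib

open scoped NNReal

/-- A resource allocation game: agents `0, …, n - 1` (in their order of play), a finite set of
resources, a nonempty finite set of actions for every agent, each action being a set of resources,
and a welfare rule and a utility rule for every resource. -/
structure AllocationGame where
  n : ℕ
  Resource : Type
  [fintypeResource : Fintype Resource]
  [decEqResource : DecidableEq Resource]
  actions : Fin n → Finset (Finset Resource)
  actions_nonempty : ∀ i, (actions i).Nonempty
  welfareRule : Resource → ℕ → ℝ
  utilityRule : Resource → ℕ → ℝ

attribute [instance] AllocationGame.fintypeResource AllocationGame.decEqResource

namespace AllocationGame

variable (G : AllocationGame)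

/-- A profile assigns a set of resources to every agent (not necessarily one of its actions). -/
abbrev Profile : Type := Fin G.n → Finset G.Resource

/-- The set of joint actions. -/
def jointActions : Set G.Profile := {a | ∀ i, a i ∈ G.actions i}

/-- The number of agents that select the resource `r` in `a`. -/
def load (a : G.Profile) (r : G.Resource) : ℕ :=
  (Finset.univ.filter fun i : Fin G.n => r ∈ a i).card

/-- The system welfare: the sum of `w_r(|a|_r)` over the resources selected by some agent. -/
def welfare (a : G.Profile) : ℝ :=
  ∑ r ∈ Finset.univ.biUnion a, G.welfareRule r (G.load a r)

/-- The utility of agent `i`. -/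
def utility (i : Fin G.n) (a : G.Profile) : ℝ :=
  ∑ r ∈ a i, G.utilityRule r (G.load a r)

/-- `b` is a best response of agent `i` to what the others do in `a`. -/
def IsBestResponse (i : Fin G.n) (a : G.Profile) (b : Finset G.Resource) : Prop :=
  b ∈ G.actions i ∧ ∀ c ∈ G.actions i,
    G.utility i (Function.update a i c) ≤ G.utility i (Function.update a i b)

/-- `a 0, a 1, …, a (k * n)` is a trajectory of the `k`-round walk: it starts with no resource
being used, and in step `τ` agent `τ mod n` moves to one of its best responses while
the others do not move. -/
def IsWalk (k : ℕ) (a : ℕ → G.Profile) : Prop :=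
  a 0 = (fun _ => ∅) ∧
    ∀ τ < k * G.n, ∀ i : Fin G.n, (i : ℕ) = τ % G.n →
      G.IsBestResponse i (a τ) (a (τ + 1) i) ∧ ∀ j, j ≠ i → a (τ + 1) j = a τ j

/-- The profiles that can be reached at the end of a `k`-round walk. -/
def walkEnds (k : ℕ) : Set G.Profile := {b | ∃ a, G.IsWalk k a ∧ a (k * G.n) = b}

/-- The set of (pure) Nash equilibria. -/
def nashEquilibria : Set G.Profile := {a | ∀ i, G.IsBestResponse i a (a i)}

/-- The largest welfare of a joint action (a maximum, over a finite nonempty set). -/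
noncomputable def optimalWelfare : ℝ := sSup (G.welfare '' G.jointActions)

/-- The efficiency of the `k`-round walk: the smallest welfare at the end of a walk, relative to
the largest welfare of a joint action. -/
noncomputable def efficiency (k : ℕ) : ℝ := sInf (G.welfare '' G.walkEnds k) / G.optimalWelfare

/-- The price of anarchy: the smallest welfare of a Nash equilibrium, relative to
the largest welfare of a joint action. -/
noncomputable def priceOfAnarchy : ℝ := sInf (G.welfare '' G.nashEquilibria) / G.optimalWelfare

end AllocationGame

/-- The submodular welfare rules: `w 0 = 0`, `w` is positive at `1, 2, …`, nondecreasing, and has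
nonincreasing increments. -/
def submodularRules : Set (ℕ → ℝ) :=
  {w | w 0 = 0 ∧ (∀ j, 1 ≤ j → 0 < w j) ∧ (∀ j, w j ≤ w (j + 1)) ∧
    ∀ j, w (j + 2) - w (j + 1) ≤ w (j + 1) - w j}

/-- A utility design for the set `𝒲` of welfare rules: it assigns to every rule in `𝒲` a
nonnegative utility rule. -/
abbrev UtilityDesign (𝒲 : Set (ℕ → ℝ)) : Type := 𝒲 → ℕ → ℝ≥0

namespace UtilityDesign

variable {𝒲 : Set (ℕ → ℝ)}

/-- The games induced by `𝒲` and a utility design. Games in which no joint action has a positive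
welfare, where the efficiency ratios would be `0 / 0`, are left out. -/
def games (F : UtilityDesign 𝒲) : Set AllocationGame :=
  {G | (∀ r, ∃ h : G.welfareRule r ∈ 𝒲, ∀ j,
      G.utilityRule r j = (F ⟨G.welfareRule r, h⟩ j : ℝ)) ∧
    ∃ a ∈ G.jointActions, 0 < G.welfare a}

/-- The guaranteed efficiency of the `k`-round walk over all induced games. -/
noncomputable def efficiency (F : UtilityDesign 𝒲) (k : ℕ) : ℝ :=
  sInf ((fun G : AllocationGame => G.efficiency k) '' F.games)

/-- The guaranteed price of anarchy over all induced games. -/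
noncomputable def priceOfAnarchy (F : UtilityDesign 𝒲) : ℝ :=
  sInf (AllocationGame.priceOfAnarchy '' F.games)

/-- `F` maximizes the guaranteed price of anarchy among all utility designs. -/
def IsPoAOptimal (F : UtilityDesign 𝒲) : Prop :=
  ∀ F' : UtilityDesign 𝒲, F'.priceOfAnarchy ≤ F.priceOfAnarchy

/-- `F` maximizes the guaranteed efficiency of the one-round walk among all utility designs. -/
def IsOneRoundOptimal (F : UtilityDesign 𝒲) : Prop :=
  ∀ F' : UtilityDesign 𝒲, F'.efficiency 1 ≤ F.efficiency 1

/-- Every utility rule that `F` assigns is nonincreasing on `1, 2, …`. -/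
def IsNonincreasing (F : UtilityDesign 𝒲) : Prop :=
  ∀ w : 𝒲, ∀ j, 1 ≤ j → F w (j + 1) ≤ F w j

end UtilityDesign

/-! Lower bounds are proved resource by resource. Upper bounds come from games with at most two
actions per agent (`duel`), where copies of resources supply integer weights, so nothing is assumed
about how a design reacts to scaling a rule.

Price of anarchy: summing the equilibrium conditions reduces a lower bound to the inequality in
`le_priceOfAnarchy`. The Filmus–Ward utilities, marginal contributions averaged over binomial
samples with density proportional to e^p, satisfy it with constant e/(e-1) (`filmusWard_smooth`).
Conversely, let f be the utility rule of a coverage rule. A price of anarchy C > 0 forces f(j+1) ≥ j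
f(j) - χ f(1) whenever χ ≥ 0 and C(1+χ) ≥ 1 (`utility_succ_ge`), so f(j+1) ≥ j! f(1) (1 - χ
∑_{1≤i≤j} 1/i!). If C > 1 - 1/e, then f(j) eventually exceeds f(1), and arbitrarily many agents may
crowd one resource in equilibrium: a contradiction. If C = 1 - 1/e, then still f(j) ≥ f(1)/(2j); in
a walk the agents may pile up on one resource and forgo a harmonic sum of welfare, so the efficiency
is 0.

One round: under marginal contributions the walk is a greedy algorithm and secures half the optimum
(`welfare_le_two_mul_of_walk`); two indistinguishable resources show that no design does better.
Efficiency 1/2 makes the sole-user utility of a coverage rule proportional to its value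
(`utility_mul_le`), so private resources can be calibrated to tie with any other resource. The
resulting inequality `le_of_efficiency` implies smoothness with constant 2 for nonincreasing
designs. It also gives f(2) = 0 for the coverage rule of value 1, so a second user may as well idle,
which caps the price of anarchy at 1/2. -/

namespace AllocationGame

/-! ### Best responses, equilibria and walks. -/

variable (G : AllocationGame)

/-- The number of agents other than `i` that select `r`. -/
def othersLoad (i : Fin G.n) (a : G.Profile) (r : G.Resource) : ℕ :=
  (Finset.univ.filter fun k : Fin G.n => k ≠ i ∧ r ∈ a k).card

theorem load_eq_othersLoad_add (i : Fin G.n) (a : G.Profile) (r : G.Resource) :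
    G.load a r = G.othersLoad i a r + if r ∈ a i then 1 else 0 := by
  unfold load othersLoad
  rw [Finset.card_filter, Finset.card_filter, ← Finset.add_sum_erase _ _ (Finset.mem_univ i),
    ← Finset.add_sum_erase _ (fun k => if k ≠ i ∧ r ∈ a k then 1 else 0) (Finset.mem_univ i)]
  simp only [ne_eq, not_true_eq_false, false_and, if_false, zero_add]
  rw [add_comm]
  congr 1
  refine Finset.sum_congr rfl fun k hk => ?_
  simp [Finset.ne_of_mem_erase hk]

theorem othersLoad_update (i : Fin G.n) (a : G.Profile) (c : Finset G.Resource)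
    (r : G.Resource) : G.othersLoad i (Function.update a i c) r = G.othersLoad i a r := by
  unfold othersLoad
  congr 1
  ext k
  simp only [Finset.mem_filter, Finset.mem_univ, true_and]
  refine and_congr_right fun hk => ?_
  rw [Function.update_of_ne hk]

theorem load_update (i : Fin G.n) (a : G.Profile) (c : Finset G.Resource) (r : G.Resource) :
    G.load (Function.update a i c) r = G.othersLoad i a r + if r ∈ c then 1 else 0 := by
  rw [G.load_eq_othersLoad_add i, othersLoad_update, Function.update_self]

theorem utility_update (i : Fin G.n) (a : G.Profile) (c : Finset G.Resource) :
    G.utility i (Function.update a i c) =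
      ∑ r ∈ c, G.utilityRule r (G.othersLoad i a r + 1) := by
  unfold utility
  rw [Function.update_self]
  refine Finset.sum_congr rfl fun r hr => ?_
  rw [load_update, if_pos hr]

theorem utility_eq (i : Fin G.n) (a : G.Profile) :
    G.utility i a = ∑ r ∈ a i, G.utilityRule r (G.othersLoad i a r + 1) := by
  rw [← utility_update, Function.update_eq_self]

theorem isBestResponse_iff (i : Fin G.n) (a : G.Profile) (b : Finset G.Resource) :
    G.IsBestResponse i a b ↔ b ∈ G.actions i ∧ ∀ c ∈ G.actions i,
      ∑ r ∈ c, G.utilityRule r (G.othersLoad i a r + 1) ≤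
        ∑ r ∈ b, G.utilityRule r (G.othersLoad i a r + 1) := by
  simp only [IsBestResponse, utility_update]

theorem exists_isBestResponse (i : Fin G.n) (a : G.Profile) : ∃ b, G.IsBestResponse i a b := by
  obtain ⟨b, hb, h⟩ := (G.actions i).exists_max_image
    (fun c => G.utility i (Function.update a i c)) (G.actions_nonempty i)
  exact ⟨b, hb, h⟩

theorem jointActions_nonempty : G.jointActions.Nonempty :=
  ⟨fun i => (G.actions_nonempty i).choose, fun i => (G.actions_nonempty i).choose_spec⟩

/-- Every resource allocation game has a pure Nash equilibrium. -/
theorem nashEquilibria_nonempty : G.nashEquilibria.Nonempty := by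
  -- Rosenthal's potential: a unilateral move changes it by the mover's change in utility, so a
  -- maximizer is an equilibrium.
  let Φ : G.Profile → ℝ := fun a =>
    ∑ r, ∑ j ∈ Finset.range (G.load a r), G.utilityRule r (j + 1)
  have hΦ : ∀ i a c, Φ (Function.update a i c) =
      ∑ r, ∑ j ∈ Finset.range (G.othersLoad i a r), G.utilityRule r (j + 1) +
        G.utility i (Function.update a i c) := by
    intro i a c
    have hc : ∑ r ∈ c, G.utilityRule r (G.othersLoad i a r + 1) =
        ∑ r, if r ∈ c then G.utilityRule r (G.othersLoad i a r + 1) else 0 := by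
      rw [Finset.sum_ite_mem, Finset.univ_inter]
    rw [utility_update, hc, ← Finset.sum_add_distrib]
    refine Finset.sum_congr rfl fun r _ => ?_
    rw [load_update]
    split_ifs with h
    · rw [Finset.sum_range_succ]
    · simp
  obtain ⟨a, ha, hmax⟩ := Set.exists_max_image G.jointActions Φ (Set.toFinite _)
    G.jointActions_nonempty
  refine ⟨a, fun i => ⟨ha i, fun c hc => ?_⟩⟩
  have hmem : Function.update a i c ∈ G.jointActions := by
    intro k
    by_cases hk : k = i
    · subst hk; simpa using hc
    · rw [Function.update_of_ne hk]; exact ha k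
  have h := hmax _ hmem
  rw [hΦ i a c] at h
  have h' := hΦ i a (a i)
  rw [Function.update_eq_self] at h' ⊢
  linarith

/-- If every `b i` is a best response of `i` when exactly the agents before `i` have moved, to the
actions prescribed by `b`, then `b` ends a one-round walk. -/
theorem mem_walkEnds_one (b : G.Profile)
    (h : ∀ i, G.IsBestResponse i (fun k => if k < i then b k else ∅) (b i)) :
    b ∈ G.walkEnds 1 := by
  refine ⟨fun τ k => if (k : ℕ) < τ then b k else ∅, ⟨by simp, ?_⟩, by simp⟩
  intro τ hτ i hi
  rw [one_mul] at hτ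
  rw [Nat.mod_eq_of_lt hτ] at hi
  subst hi
  refine ⟨by simpa using h i, fun j hj => ?_⟩
  have : (j : ℕ) ≠ i := fun h => hj (Fin.ext h)
  have h2 : (j : ℕ) < i + 1 ↔ (j : ℕ) < i := by omega
  simp [h2]

/-- Needed because `sInf ∅ = 0` in `ℝ`: without a walk the efficiency would be 0 by default. -/
theorem walkEnds_one_nonempty : (G.walkEnds 1).Nonempty := by
  choose br hbr using fun i a => G.exists_isBestResponse i a
  let a : ℕ → G.Profile := fun τ => Nat.rec (fun _ => ∅)
    (fun τ p => if h : τ < G.n then Function.update p ⟨τ, h⟩ (br ⟨τ, h⟩ p) else p) τ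
  have ha : ∀ τ (h : τ < G.n),
      a (τ + 1) = Function.update (a τ) ⟨τ, h⟩ (br ⟨τ, h⟩ (a τ)) := fun τ h => by
    simp [a, h]
  refine ⟨_, a, ⟨rfl, fun τ hτ i hi => ?_⟩, rfl⟩
  rw [one_mul] at hτ
  rw [Nat.mod_eq_of_lt hτ] at hi
  obtain rfl : i = ⟨τ, hτ⟩ := Fin.ext hi
  rw [ha τ hτ]
  refine ⟨by simpa using hbr _ _, fun j hj => Function.update_of_ne hj _ _⟩

theorem welfare_eq_sum (h0 : ∀ r, G.welfareRule r 0 = 0) (a : G.Profile) :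
    G.welfare a = ∑ r, G.welfareRule r (G.load a r) := by
  unfold welfare
  refine Finset.sum_subset (Finset.subset_univ _) fun r _ hr => ?_
  have : G.load a r = 0 := by
    unfold load
    rw [Finset.card_eq_zero, Finset.filter_eq_empty_iff]
    intro i _ hi
    exact hr (Finset.mem_biUnion.2 ⟨i, Finset.mem_univ _, hi⟩)
  rw [this, h0]

theorem welfare_le_optimalWelfare {a : G.Profile} (ha : a ∈ G.jointActions) :
    G.welfare a ≤ G.optimalWelfare :=
  le_csSup (Set.toFinite _).bddAbove ⟨a, ha, rfl⟩

theorem exists_welfare_eq_optimalWelfare :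
    ∃ a ∈ G.jointActions, G.welfare a = G.optimalWelfare :=
  (G.jointActions_nonempty.image G.welfare).csSup_mem (Set.toFinite _)

end AllocationGame

/-! ### Submodular welfare rules. -/

namespace submodularRules

variable {w : ℕ → ℝ}

theorem nonneg (hw : w ∈ submodularRules) (j : ℕ) : 0 ≤ w j := by
  rcases Nat.eq_zero_or_pos j with rfl | hj
  · exact hw.1.ge
  · exact (hw.2.1 j hj).le

theorem monotone (hw : w ∈ submodularRules) : Monotone w :=
  monotone_nat_of_le_succ hw.2.2.1

theorem antitone_increment (hw : w ∈ submodularRules) : Antitone fun j => w (j + 1) - w j :=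
  antitone_nat_of_succ_le hw.2.2.2

/-- Monotonicity replaces `m` by `i + m`, and none of the `m` increments after `i` exceeds the
first. Both lower bounds compare the optimum with the outcome through this. -/
theorem le_add_mul_increment (hw : w ∈ submodularRules) (i m : ℕ) :
    w m ≤ w i + m * (w (i + 1) - w i) := by
  refine (monotone hw (Nat.le_add_left m i)).trans ?_
  induction m with
  | zero => simp
  | succ m ih =>
    have h := antitone_increment hw (Nat.le_add_right i m)
    simp only at h
    push_cast
    rw [← add_assoc]
    linarith

end submodularRules

/-! ### Efficiency ratios, two-action games and smoothness. -/

namespace UtilityDesign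

variable {F : UtilityDesign submodularRules} {G : AllocationGame}

theorem welfare_eq_sum (hG : G ∈ F.games) (a : G.Profile) :
    G.welfare a = ∑ r, G.welfareRule r (G.load a r) :=
  G.welfare_eq_sum (fun r => (hG.1 r).1.1) a

theorem welfare_nonneg (hG : G ∈ F.games) (a : G.Profile) : 0 ≤ G.welfare a := by
  rw [welfare_eq_sum hG]
  exact Finset.sum_nonneg fun r _ => submodularRules.nonneg (hG.1 r).1 _

theorem optimalWelfare_pos (hG : G ∈ F.games) : 0 < G.optimalWelfare := by
  obtain ⟨a, ha, h⟩ := hG.2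
  exact h.trans_le (G.welfare_le_optimalWelfare ha)

theorem ratio_nonneg (hG : G ∈ F.games) (S : Set G.Profile) :
    0 ≤ sInf (G.welfare '' S) / G.optimalWelfare := by
  refine div_nonneg (Real.sInf_nonneg ?_) (optimalWelfare_pos hG).le
  rintro _ ⟨a, _, rfl⟩
  exact welfare_nonneg hG a

theorem ratio_mul_le (hG : G ∈ F.games) {S : Set G.Profile} {b o : G.Profile} (hb : b ∈ S)
    (ho : o ∈ G.jointActions) :
    sInf (G.welfare '' S) / G.optimalWelfare * G.welfare o ≤ G.welfare b := by
  calc _ ≤ sInf (G.welfare '' S) / G.optimalWelfare * G.optimalWelfare :=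
        mul_le_mul_of_nonneg_left (G.welfare_le_optimalWelfare ho) (ratio_nonneg hG S)
    _ = sInf (G.welfare '' S) := div_mul_cancel₀ _ (optimalWelfare_pos hG).ne'
    _ ≤ G.welfare b := csInf_le (Set.toFinite _).bddBelow ⟨b, hb, rfl⟩

theorem le_ratio (hG : G ∈ F.games) {S : Set G.Profile} (hS : S.Nonempty) {D : ℝ} (hD : 0 < D)
    (h : ∀ b ∈ S, ∀ o ∈ G.jointActions, G.welfare o ≤ D * G.welfare b) :
    1 / D ≤ sInf (G.welfare '' S) / G.optimalWelfare := by
  rw [div_le_div_iff₀ hD (optimalWelfare_pos hG), one_mul]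
  obtain ⟨o, ho, hoW⟩ := G.exists_welfare_eq_optimalWelfare
  obtain ⟨b, hb, hbW⟩ := (hS.image G.welfare).csInf_mem (Set.toFinite _)
  rw [← hoW, ← hbW, mul_comm]
  exact h b hb o ho

theorem efficiency_nonneg (F : UtilityDesign submodularRules) (k : ℕ) : 0 ≤ F.efficiency k := by
  refine Real.sInf_nonneg ?_
  rintro _ ⟨G, hG, rfl⟩
  exact ratio_nonneg hG _

theorem efficiency_mul_le (hG : G ∈ F.games) {k : ℕ} {b o : G.Profile} (hb : b ∈ G.walkEnds k)
    (ho : o ∈ G.jointActions) : F.efficiency k * G.welfare o ≤ G.welfare b := by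
  refine le_trans (mul_le_mul_of_nonneg_right ?_ (welfare_nonneg hG o)) (ratio_mul_le hG hb ho)
  refine csInf_le ⟨0, ?_⟩ ⟨G, hG, rfl⟩
  rintro _ ⟨G, hG, rfl⟩
  exact ratio_nonneg hG _

theorem priceOfAnarchy_mul_le (hG : G ∈ F.games) {b o : G.Profile} (hb : b ∈ G.nashEquilibria)
    (ho : o ∈ G.jointActions) : F.priceOfAnarchy * G.welfare o ≤ G.welfare b := by
  refine le_trans (mul_le_mul_of_nonneg_right ?_ (welfare_nonneg hG o)) (ratio_mul_le hG hb ho)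
  refine csInf_le ⟨0, ?_⟩ ⟨G, hG, rfl⟩
  rintro _ ⟨G, hG, rfl⟩
  exact ratio_nonneg hG _

/-- The game in which agent `i` chooses between `b i` and `o i`, and where the resource `x` with
the welfare rule `ρ x` is present in `m x` copies that are always used together. -/
@[reducible] def duel (F : UtilityDesign submodularRules) (n : ℕ) {X : Type} [Fintype X] [DecidableEq X]
    (m : X → ℕ) (ρ : X → submodularRules) (b o : Fin n → Finset X) : AllocationGame where
  n := n
  Resource := Σ x : X, Fin (m x)
  actions i := {(b i).sigma fun _ => Finset.univ, (o i).sigma fun _ => Finset.univ}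
  actions_nonempty _ := ⟨_, Finset.mem_insert_self _ _⟩
  welfareRule r := ρ r.1
  utilityRule r j := F (ρ r.1) j

section duel

variable (F : UtilityDesign submodularRules) {n : ℕ} {X : Type} [Fintype X] [DecidableEq X]
  (m : X → ℕ) (ρ : X → submodularRules) (b o : Fin n → Finset X)

theorem duel_welfare (a : Fin n → Finset X) :
    (F.duel n m ρ b o).welfare (fun i => (a i).sigma fun _ => Finset.univ) =
      ∑ x, m x * (ρ x : ℕ → ℝ) (Finset.univ.filter fun k => x ∈ a k).card := by
  rw [AllocationGame.welfare_eq_sum (F.duel n m ρ b o) fun r => (ρ r.1).2.1]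
  rw [Fintype.sum_sigma]
  refine Finset.sum_congr rfl fun x _ => ?_
  simp [AllocationGame.load]

theorem duel_mem_games (h : 0 < ∑ x, m x * (ρ x : ℕ → ℝ) (Finset.univ.filter fun k => x ∈ o k).card) :
    F.duel n m ρ b o ∈ F.games := by
  refine ⟨fun r => ⟨(ρ r.1).2, fun j => rfl⟩, fun i => (o i).sigma fun _ => Finset.univ,
    fun i => by simp, ?_⟩
  rw [duel_welfare]
  exact h

theorem duel_welfare_nonneg (a : Fin n → Finset X) :
    0 ≤ ∑ x, m x * (ρ x : ℕ → ℝ) (Finset.univ.filter fun k => x ∈ a k).card :=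
  Finset.sum_nonneg fun x _ => mul_nonneg (Nat.cast_nonneg _) (submodularRules.nonneg (ρ x).2 _)

/-- A sequence of moves `b` in which nobody gains by choosing `o i` instead of `b i`
bounds the efficiency of the one-round walk. -/
theorem efficiency_mul_le_of_sequential
    (h : ∀ i, ∑ x ∈ o i, m x * (F (ρ x) ((Finset.univ.filter fun k => k < i ∧ x ∈ b k).card + 1) : ℝ) ≤
      ∑ x ∈ b i, m x * (F (ρ x) ((Finset.univ.filter fun k => k < i ∧ x ∈ b k).card + 1) : ℝ)) :
    F.efficiency 1 * ∑ x, m x * (ρ x : ℕ → ℝ) (Finset.univ.filter fun k => x ∈ o k).card ≤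
      ∑ x, m x * (ρ x : ℕ → ℝ) (Finset.univ.filter fun k => x ∈ b k).card := by
  -- If `o` has welfare 0 the game may lie outside the class, but then the bound is trivial.
  rcases (duel_welfare_nonneg m ρ o).eq_or_lt with h0 | hpos
  · rw [← h0, mul_zero]
    exact duel_welfare_nonneg m ρ b
  have key := efficiency_mul_le (duel_mem_games F m ρ b o hpos) (k := 1)
    (b := fun i => (b i).sigma fun _ => Finset.univ)
    (o := fun i => (o i).sigma fun _ => Finset.univ) ?_ (fun i => by simp)
  · rwa [duel_welfare, duel_welfare] at key
  refine AllocationGame.mem_walkEnds_one _ _ fun i => ?_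
  rw [AllocationGame.isBestResponse_iff]
  refine ⟨by simp, fun c hc => ?_⟩
  have hload : ∀ r : Σ x : X, Fin (m x), (F.duel n m ρ b o).othersLoad i
      (fun k => if k < i then (b k).sigma fun _ => Finset.univ else ∅) r =
        (Finset.univ.filter fun k => k < i ∧ r.1 ∈ b k).card := by
    intro r
    unfold AllocationGame.othersLoad
    congr 1
    ext k
    by_cases hk : k < i
    · simp [hk, hk.ne]
    · simp [hk]
  simp only [hload]
  rcases Finset.mem_insert.1 hc with rfl | hc
  · exact le_rfl
  · rw [Finset.mem_singleton] at hc
    subst hc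
    rw [Finset.sum_sigma, Finset.sum_sigma]
    simpa using h i

/-- A profile `b` in which nobody gains by choosing `o i` instead of `b i` bounds the price of
anarchy. -/
theorem priceOfAnarchy_mul_le_of_equilibrium
    (h : ∀ i, ∑ x ∈ o i, m x * (F (ρ x) ((Finset.univ.filter fun k => k ≠ i ∧ x ∈ b k).card + 1) : ℝ) ≤
      ∑ x ∈ b i, m x * (F (ρ x) ((Finset.univ.filter fun k => k ≠ i ∧ x ∈ b k).card + 1) : ℝ)) :
    F.priceOfAnarchy * ∑ x, m x * (ρ x : ℕ → ℝ) (Finset.univ.filter fun k => x ∈ o k).card ≤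
      ∑ x, m x * (ρ x : ℕ → ℝ) (Finset.univ.filter fun k => x ∈ b k).card := by
  rcases (duel_welfare_nonneg m ρ o).eq_or_lt with h0 | hpos
  · rw [← h0, mul_zero]
    exact duel_welfare_nonneg m ρ b
  have key := priceOfAnarchy_mul_le (duel_mem_games F m ρ b o hpos)
    (b := fun i => (b i).sigma fun _ => Finset.univ)
    (o := fun i => (o i).sigma fun _ => Finset.univ) ?_ (fun i => by simp)
  · rwa [duel_welfare, duel_welfare] at key
  intro i
  rw [AllocationGame.isBestResponse_iff]
  refine ⟨by simp, fun c hc => ?_⟩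
  have hload : ∀ r : Σ x : X, Fin (m x), (F.duel n m ρ b o).othersLoad i
      (fun k => (b k).sigma fun _ => Finset.univ) r =
        (Finset.univ.filter fun k => k ≠ i ∧ r.1 ∈ b k).card := by
    intro r
    unfold AllocationGame.othersLoad
    congr 1
    ext k
    simp
  simp only [hload]
  rcases Finset.mem_insert.1 hc with rfl | hc
  · exact le_rfl
  · rw [Finset.mem_singleton] at hc
    subst hc
    rw [Finset.sum_sigma, Finset.sum_sigma]
    simpa using h i

end duel

/-- The rule with the value `v` as soon as the resource is used. -/
noncomputable def coverageRule (v : ℝ) (hv : 0 < v) : submodularRules :=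
  ⟨fun j => if j = 0 then 0 else v, by simp, fun j hj => by
    beta_reduce
    rwa [if_neg (Nat.one_le_iff_ne_zero.1 hj)], fun j => by
    by_cases hj : j = 0 <;> simp [hj, hv.le], fun j => by
    by_cases hj : j = 0 <;> simp [hj, hv.le]⟩

theorem coverageRule_apply (v : ℝ) (hv : 0 < v) (j : ℕ) :
    (coverageRule v hv : ℕ → ℝ) j = if j = 0 then 0 else v := rfl

theorem games_nonempty (F : UtilityDesign submodularRules) : F.games.Nonempty := by
  refine ⟨_, duel_mem_games F (n := 1) (X := Unit) (fun _ => 1)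
    (fun _ => coverageRule 1 one_pos) (fun _ => ∅) (fun _ => {()}) ?_⟩
  simp [coverageRule_apply]

theorem le_efficiency (F : UtilityDesign submodularRules) {D : ℝ} (hD : 0 < D)
    (h : ∀ G ∈ F.games, ∀ b ∈ G.walkEnds 1, ∀ o ∈ G.jointActions,
      G.welfare o ≤ D * G.welfare b) : 1 / D ≤ F.efficiency 1 := by
  refine le_csInf (F.games_nonempty.image _) ?_
  rintro _ ⟨G, hG, rfl⟩
  exact le_ratio hG G.walkEnds_one_nonempty hD (h G hG)

/-- A smoothness condition for each welfare rule bounds the price of anarchy from below. -/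
theorem le_priceOfAnarchy (F : UtilityDesign submodularRules) {D κ : ℝ} (hD : 0 < D) (hκ : 0 ≤ κ)
    (h : ∀ (w : submodularRules) (a b c : ℕ), (w : ℕ → ℝ) (b + c) +
      κ * (a * F w (a + b) - c * F w (a + b + 1)) ≤ D * (w : ℕ → ℝ) (a + b)) :
    1 / D ≤ F.priceOfAnarchy := by
  refine le_csInf (F.games_nonempty.image _) ?_
  rintro _ ⟨G, hG, rfl⟩
  refine le_ratio hG G.nashEquilibria_nonempty hD fun a ha o ho => ?_
  have h1 : ∀ i, ∑ r ∈ o i, G.utilityRule r (G.othersLoad i a r + 1) ≤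
      ∑ r ∈ a i, G.utilityRule r (G.othersLoad i a r + 1) :=
    fun i => ((G.isBestResponse_iff i a _).1 (ha i)).2 _ (ho i)
  -- The equilibrium conditions summed over agents, regrouped by resource so that the hypothesis
  -- applies to each resource separately.
  have h2 : 0 ≤ ∑ r, ∑ i, ((if r ∈ a i then G.utilityRule r (G.othersLoad i a r + 1) else 0) -
      if r ∈ o i then G.utilityRule r (G.othersLoad i a r + 1) else 0) := by
    rw [Finset.sum_comm]
    refine Finset.sum_nonneg fun i _ => ?_
    rw [Finset.sum_sub_distrib, Finset.sum_ite_mem, Finset.sum_ite_mem, Finset.univ_inter,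
      Finset.univ_inter]
    exact sub_nonneg.2 (h1 i)
  rw [welfare_eq_sum hG, welfare_eq_sum hG]
  refine (le_add_of_nonneg_right (mul_nonneg hκ h2)).trans ?_
  rw [Finset.mul_sum, Finset.mul_sum, ← Finset.sum_add_distrib]
  refine Finset.sum_le_sum fun r _ => ?_
  obtain ⟨hw, hu⟩ := hG.1 r
  -- The users of `r` only in equilibrium, in both profiles, and only in the optimum; the middle
  -- group cancels from the utility difference.
  have key := h ⟨_, hw⟩ (Finset.univ.filter fun i => r ∈ a i ∧ r ∉ o i).card
    (Finset.univ.filter fun i => r ∈ a i ∧ r ∈ o i).card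
    (Finset.univ.filter fun i => r ∉ a i ∧ r ∈ o i).card
  have hload : G.load a r = (Finset.univ.filter fun i => r ∈ a i ∧ r ∉ o i).card +
      (Finset.univ.filter fun i => r ∈ a i ∧ r ∈ o i).card := by
    rw [add_comm]
    unfold AllocationGame.load
    simp only [← Finset.filter_filter]
    rw [Finset.card_filter_add_card_filter_not]
  have hload' : G.load o r = (Finset.univ.filter fun i => r ∈ a i ∧ r ∈ o i).card +
      (Finset.univ.filter fun i => r ∉ a i ∧ r ∈ o i).card := by
    unfold AllocationGame.load
    simp only [and_comm (b := r ∈ o _), ← Finset.filter_filter]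
    rw [Finset.card_filter_add_card_filter_not]
  rw [← hload, ← hload', ← hu, ← hu] at key
  refine le_trans (le_of_eq ?_) key
  congr 2
  rw [Finset.card_filter, Finset.card_filter]
  push_cast
  rw [Finset.sum_mul, Finset.sum_mul, ← Finset.sum_sub_distrib]
  refine Finset.sum_congr rfl fun i _ => ?_
  have hi := G.load_eq_othersLoad_add i a r
  by_cases h1 : r ∈ a i <;> by_cases h2 : r ∈ o i <;> simp [h1, h2] at hi ⊢ <;> rw [hi]

end UtilityDesign

/-! ### Binomial means and the Filmus–Ward design. -/

/-- The expectation of `g` at a binomial random variable with parameters `j` and `p`. -/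
noncomputable def binomialMean (p : ℝ) : ℕ → (ℕ → ℝ) → ℝ
  | 0, g => g 0
  | j + 1, g => (1 - p) * binomialMean p j g + p * binomialMean p j fun i => g (i + 1)

namespace binomialMean

theorem add (p : ℝ) (j : ℕ) (g h : ℕ → ℝ) :
    binomialMean p j (fun i => g i + h i) = binomialMean p j g + binomialMean p j h := by
  induction j generalizing g h with
  | zero => rfl
  | succ j ih => simp only [binomialMean, ih]; ring

theorem const_mul (p : ℝ) (j : ℕ) (c : ℝ) (g : ℕ → ℝ) :
    binomialMean p j (fun i => c * g i) = c * binomialMean p j g := by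
  induction j generalizing g with
  | zero => rfl
  | succ j ih => simp only [binomialMean, ih]; ring

theorem sub (p : ℝ) (j : ℕ) (g h : ℕ → ℝ) :
    binomialMean p j (fun i => g i - h i) = binomialMean p j g - binomialMean p j h := by
  induction j generalizing g h with
  | zero => rfl
  | succ j ih => simp only [binomialMean, ih]; ring

theorem const (p : ℝ) (j : ℕ) (c : ℝ) : binomialMean p j (fun _ => c) = c := by
  induction j with
  | zero => rfl
  | succ j ih => simp only [binomialMean, ih]; ring

theorem mono {p : ℝ} (h0 : 0 ≤ p) (h1 : p ≤ 1) (j : ℕ) {g h : ℕ → ℝ} (hgh : ∀ i, g i ≤ h i) :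
    binomialMean p j g ≤ binomialMean p j h := by
  induction j generalizing g h with
  | zero => exact hgh 0
  | succ j ih =>
    exact add_le_add (mul_le_mul_of_nonneg_left (ih hgh) (sub_nonneg.2 h1))
      (mul_le_mul_of_nonneg_left (ih fun i => hgh (i + 1)) h0)

/-- One more trial can only raise the count. -/
theorem succ_le {p : ℝ} (h0 : 0 ≤ p) (h1 : p ≤ 1) (j : ℕ) {g : ℕ → ℝ} (hg : Antitone g) :
    binomialMean p (j + 1) g ≤ binomialMean p j g := by
  have := mul_le_mul_of_nonneg_left (mono h0 h1 j fun i => hg (Nat.le_succ i)) h0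
  simp only [binomialMean]
  simp only [Nat.succ_eq_add_one] at this
  linarith

theorem apply_zero (j : ℕ) (g : ℕ → ℝ) : binomialMean 0 j g = g 0 := by
  induction j generalizing g with
  | zero => rfl
  | succ j ih => simp [binomialMean, ih]

theorem apply_one (j : ℕ) (g : ℕ → ℝ) : binomialMean 1 j g = g j := by
  induction j generalizing g with
  | zero => rfl
  | succ j ih => simp [binomialMean, ih]

@[fun_prop]
theorem continuous (j : ℕ) (g : ℕ → ℝ) : Continuous fun p => binomialMean p j g := by
  induction j generalizing g with
  | zero => exact continuous_const
  | succ j ih =>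
    have := ih g
    have := ih fun i => g (i + 1)
    simp only [binomialMean]
    fun_prop

/-- The derivative formula for Bernstein polynomials; it ties averaged marginal contributions to
averaged welfare. -/
theorem hasDerivAt (j : ℕ) (g : ℕ → ℝ) (p : ℝ) :
    HasDerivAt (fun p => binomialMean p (j + 1) g)
      ((j + 1) * binomialMean p j fun i => g (i + 1) - g i) p := by
  induction j generalizing g with
  | zero =>
    simp only [binomialMean]
    refine ((((hasDerivAt_id p).const_sub 1).mul_const (g 0)).add
      ((hasDerivAt_id p).mul_const (g 1))).congr_deriv ?_
    push_cast
    ring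
  | succ j ih =>
    have h1 := ((hasDerivAt_id p).const_sub 1).mul (ih g)
    have h2 := (hasDerivAt_id p).mul (ih fun i => g (i + 1))
    refine (h1.add h2).congr_deriv ?_
    have e : binomialMean p (j + 1) (fun i => g (i + 1) - g i) =
      (1 - p) * binomialMean p j (fun i => g (i + 1) - g i) +
        p * binomialMean p j (fun i => g (i + 1 + 1) - g (i + 1)) := rfl
    have e' := sub p (j + 1) (fun i => g (i + 1)) g
    push_cast
    simp only [id]
    linear_combination ((j : ℝ) + 1) * -e - e'

end binomialMean

namespace UtilityDesign

/-- The marginal contributions to the potential of Filmus and Ward. -/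
noncomputable def filmusWard (w : ℕ → ℝ) : ℕ → ℝ
  | 0 => 0
  | j + 1 => ∫ p in (0 : ℝ)..1, Real.exp p / (Real.exp 1 - 1) *
      binomialMean p j fun i => w (i + 1) - w i

theorem exp_one_sub_one_pos : 0 < Real.exp 1 - 1 := by
  have := Real.exp_one_gt_d9
  linarith

theorem filmusWard_nonneg {w : ℕ → ℝ} (hw : w ∈ submodularRules) (j : ℕ) :
    0 ≤ filmusWard w j := by
  cases j with
  | zero => exact le_rfl
  | succ j =>
    refine intervalIntegral.integral_nonneg zero_le_one fun p hp => ?_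
    refine mul_nonneg (div_nonneg (Real.exp_pos p).le exp_one_sub_one_pos.le) ?_
    rw [← binomialMean.const p j 0]
    exact binomialMean.mono hp.1 hp.2 j fun i => sub_nonneg.2 (hw.2.2.1 i)

/-- Integration by parts, with e^p its own derivative; the boundary term at 0 vanishes because `w 0
= 0`. -/
theorem succ_mul_filmusWard {w : ℕ → ℝ} (hw : w ∈ submodularRules) (j : ℕ) :
    (j + 1) * filmusWard w (j + 1) = Real.exp 1 / (Real.exp 1 - 1) * w (j + 1) -
      ∫ p in (0 : ℝ)..1, Real.exp p / (Real.exp 1 - 1) * binomialMean p (j + 1) w := by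
  have h := intervalIntegral.integral_mul_deriv_eq_deriv_mul (a := 0) (b := 1)
    (u := fun p => Real.exp p / (Real.exp 1 - 1)) (v := fun p => binomialMean p (j + 1) w)
    (u' := fun p => Real.exp p / (Real.exp 1 - 1))
    (v' := fun p => (j + 1) * binomialMean p j fun i => w (i + 1) - w i)
    (fun p _ => (Real.hasDerivAt_exp p).div_const _) (fun p _ => binomialMean.hasDerivAt j w p)
    (Continuous.intervalIntegrable (by fun_prop) _ _)
    (Continuous.intervalIntegrable (by fun_prop) _ _)
  rw [binomialMean.apply_one, binomialMean.apply_zero, hw.1, mul_zero, sub_zero] at h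
  rw [← h, filmusWard, ← intervalIntegral.integral_const_mul]
  congr 1
  ext p
  ring

theorem integral_exp_div : ∫ p in (0 : ℝ)..1, Real.exp p / (Real.exp 1 - 1) = 1 := by
  rw [intervalIntegral.integral_div, integral_exp, Real.exp_zero,
    div_self exp_one_sub_one_pos.ne']

theorem le_integral_of_le {x : ℝ} {g : ℝ → ℝ} (hg : Continuous g)
    (h : ∀ p ∈ Set.Icc (0 : ℝ) 1, x ≤ g p) :
    x ≤ ∫ p in (0 : ℝ)..1, Real.exp p / (Real.exp 1 - 1) * g p := by
  calc x = ∫ p in (0 : ℝ)..1, Real.exp p / (Real.exp 1 - 1) * x := by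
        rw [intervalIntegral.integral_mul_const, integral_exp_div, one_mul]
    _ ≤ _ := by
      refine intervalIntegral.integral_mono_on zero_le_one
        (Continuous.intervalIntegrable (by fun_prop) _ _)
        (Continuous.intervalIntegrable (by fun_prop) _ _) fun p hp => ?_
      exact mul_le_mul_of_nonneg_left (h p hp)
        (div_nonneg (Real.exp_pos p).le exp_one_sub_one_pos.le)

/-- For B binomial with `a + b` trials, concavity gives w(b+c) ≤ E w(B) + (b+c) E[w(B+1) - w(B)]. In
`b` of the increments one trial is dropped, which only enlarges them. Integrating over p turns the
increments into utilities, and `succ_mul_filmusWard` evaluates the mean of w(B). -/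
theorem filmusWard_smooth {w : ℕ → ℝ} (hw : w ∈ submodularRules) (a b c : ℕ) :
    w (b + c) + 1 * (a * filmusWard w (a + b) - c * filmusWard w (a + b + 1)) ≤
      Real.exp 1 / (Real.exp 1 - 1) * w (a + b) := by
  have hΔ := submodularRules.antitone_increment hw
  have hmean : ∀ j m : ℕ, ∀ p ∈ Set.Icc (0 : ℝ) 1, w m ≤ binomialMean p j w +
      m * binomialMean p j fun i => w (i + 1) - w i := by
    intro j m p hp
    rw [← binomialMean.const_mul, ← binomialMean.add]
    conv_lhs => rw [← binomialMean.const p j (w m)]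
    exact binomialMean.mono hp.1 hp.2 j fun i => submodularRules.le_add_mul_increment hw i m
  have hint : ∀ j g, IntervalIntegrable
      (fun p => Real.exp p / (Real.exp 1 - 1) * binomialMean p j g) MeasureTheory.volume 0 1 :=
    fun j g => Continuous.intervalIntegrable (by fun_prop) _ _
  rcases Nat.eq_zero_or_pos (a + b) with h0 | hpos
  · obtain ⟨rfl, rfl⟩ : a = 0 ∧ b = 0 := by omega
    have h := le_integral_of_le (x := w c) (g := fun p => c * binomialMean p 0 fun i =>
      w (i + 1) - w i) (by fun_prop) fun p hp => by
        have := hmean 0 c p hp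
        simpa [binomialMean, hw.1] using this
    simp only [mul_left_comm _ (c : ℝ), intervalIntegral.integral_const_mul] at h
    simp only [filmusWard, hw.1, zero_add, CharP.cast_eq_zero, mul_zero, zero_sub, one_mul]
    linarith
  · obtain ⟨j, hj⟩ : ∃ j, a + b = j + 1 := ⟨a + b - 1, by omega⟩
    have h := le_integral_of_le (x := w (b + c)) (g := fun p => binomialMean p (j + 1) w +
      (b * binomialMean p j (fun i => w (i + 1) - w i) +
        c * binomialMean p (j + 1) fun i => w (i + 1) - w i)) (by fun_prop) fun p hp => by
        have h1 := hmean (j + 1) (b + c) p hp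
        have h2 := mul_le_mul_of_nonneg_left (binomialMean.succ_le hp.1 hp.2 j hΔ)
          (Nat.cast_nonneg (α := ℝ) b)
        push_cast at h1
        linarith
    simp only [mul_add, mul_left_comm _ (c : ℝ), mul_left_comm _ (b : ℝ)] at h
    rw [intervalIntegral.integral_add (hint _ _) (((hint _ _).const_mul _).add
      ((hint _ _).const_mul _)), intervalIntegral.integral_add ((hint _ _).const_mul _)
      ((hint _ _).const_mul _), intervalIntegral.integral_const_mul,
      intervalIntegral.integral_const_mul] at h
    have h3 := succ_mul_filmusWard hw j
    have ha : (a : ℝ) = j + 1 - b := by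
      have : (a + b : ℝ) = j + 1 := mod_cast hj
      linarith
    rw [hj, ha]
    simp only [filmusWard] at h h3 ⊢
    linarith

/-- The price of anarchy `1 - 1 / e` is attained. -/
theorem exists_priceOfAnarchy_ge :
    ∃ F : UtilityDesign submodularRules, 1 - 1 / Real.exp 1 ≤ F.priceOfAnarchy := by
  refine ⟨fun w j => ⟨filmusWard w j, filmusWard_nonneg w.2 j⟩, ?_⟩
  have h := le_priceOfAnarchy (fun w j => ⟨filmusWard w j, filmusWard_nonneg w.2 j⟩)
    (div_pos (Real.exp_pos 1) exp_one_sub_one_pos) zero_le_one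
    fun w a b c => filmusWard_smooth w.2 a b c
  refine le_trans (le_of_eq ?_) h
  have := Real.exp_pos 1
  have := exp_one_sub_one_pos
  field_simp

/-! ### Greedy walks under marginal contributions. -/

/-- A mover's utility is the welfare it adds, at least what `o i` would add now, hence at least what
`o i` would add at the final, larger loads. These gains telescope to the final welfare, and by
concavity they cover the excess of `o`. -/
theorem welfare_le_two_mul_of_walk {F : UtilityDesign submodularRules} {G : AllocationGame}
    (hG : G ∈ F.games) (hF : ∀ w j, (F w (j + 1) : ℝ) = (w : ℕ → ℝ) (j + 1) - (w : ℕ → ℝ) j)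
    {b o : G.Profile} (hb : b ∈ G.walkEnds 1) (ho : o ∈ G.jointActions) :
    G.welfare o ≤ 2 * G.welfare b := by
  obtain ⟨a, ⟨h0, hstep⟩, rfl⟩ := hb
  rw [one_mul] at hstep ⊢
  have hmove : ∀ τ (hτ : τ < G.n), a (τ + 1) = Function.update (a τ) ⟨τ, hτ⟩ (a (τ + 1) ⟨τ, hτ⟩) := by
    intro τ hτ
    rw [Function.eq_update_iff]
    exact ⟨rfl, fun j hj => (hstep τ hτ ⟨τ, hτ⟩ (Nat.mod_eq_of_lt hτ).symm).2 j hj⟩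
  have hunmoved : ∀ τ, τ ≤ G.n → ∀ k : Fin G.n, τ ≤ k → a τ k = ∅ := by
    intro τ
    induction τ with
    | zero => intro _ k _; rw [h0]
    | succ τ ih =>
      intro hτ k hk
      rw [(hstep τ hτ ⟨τ, hτ⟩ (Nat.mod_eq_of_lt hτ).symm).2 k (by
        rintro rfl; simp at hk)]
      exact ih (by omega) k (by omega)
  have hincr : ∀ τ (hτ : τ < G.n), ∀ r,
      G.load (a τ) r = G.othersLoad ⟨τ, hτ⟩ (a τ) r := by
    intro τ hτ r
    rw [G.load_eq_othersLoad_add ⟨τ, hτ⟩, hunmoved τ hτ.le ⟨τ, hτ⟩ le_rfl]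
    simp
  have hle : ∀ r σ, σ ≤ G.n → ∀ τ ≤ σ, G.load (a τ) r ≤ G.load (a σ) r := by
    intro r σ
    induction σ with
    | zero => intro _ τ hτ; rw [Nat.le_zero.1 hτ]
    | succ σ ih =>
      intro hσ τ hτ
      rcases Nat.le_succ_iff.1 hτ with h | rfl
      · refine (ih (by omega) τ h).trans ?_
        rw [hmove σ hσ, AllocationGame.load_update, hincr σ hσ]
        omega
      · exact le_rfl
  have hgain : ∀ τ (hτ : τ < G.n),
      ∑ r ∈ o ⟨τ, hτ⟩, (G.welfareRule r (G.load (a G.n) r + 1) - G.welfareRule r (G.load (a G.n) r))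
        ≤ G.welfare (a (τ + 1)) - G.welfare (a τ) := by
    intro τ hτ
    have hbr := ((G.isBestResponse_iff _ _ _).1
      (hstep τ hτ ⟨τ, hτ⟩ (Nat.mod_eq_of_lt hτ).symm).1).2 _ (ho ⟨τ, hτ⟩)
    have hu : ∀ r j, G.utilityRule r (j + 1) = G.welfareRule r (j + 1) - G.welfareRule r j :=
      fun r j => by
        obtain ⟨hw, hu⟩ := hG.1 r
        rw [hu, hF]
    simp only [hu, ← hincr τ hτ] at hbr
    have hdiff : G.welfare (a (τ + 1)) - G.welfare (a τ) = ∑ r ∈ a (τ + 1) ⟨τ, hτ⟩,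
        (G.welfareRule r (G.load (a τ) r + 1) - G.welfareRule r (G.load (a τ) r)) := by
      rw [welfare_eq_sum hG, welfare_eq_sum hG, ← Finset.sum_sub_distrib,
        ← Finset.univ_inter (a (τ + 1) ⟨τ, hτ⟩), ← Finset.sum_ite_mem]
      refine Finset.sum_congr rfl fun r _ => ?_
      conv_lhs => rw [hmove τ hτ]
      rw [AllocationGame.load_update, ← hincr τ hτ]
      split_ifs <;> simp
    rw [hdiff]
    refine le_trans (Finset.sum_le_sum fun r _ => ?_) hbr
    exact submodularRules.antitone_increment (hG.1 r).1 (hle r G.n le_rfl τ hτ.le)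
  have htel : ∑ i : Fin G.n, ∑ r ∈ o i,
      (G.welfareRule r (G.load (a G.n) r + 1) - G.welfareRule r (G.load (a G.n) r)) ≤
        G.welfare (a G.n) := by
    calc _ ≤ ∑ i : Fin G.n, (G.welfare (a (i + 1)) - G.welfare (a i)) :=
          Finset.sum_le_sum fun i _ => hgain i i.2
      _ = G.welfare (a G.n) - G.welfare (a 0) := by
          rw [Fin.sum_univ_eq_sum_range (fun τ => G.welfare (a (τ + 1)) - G.welfare (a τ)),
            Finset.sum_range_sub (fun τ => G.welfare (a τ))]
      _ ≤ _ := sub_le_self _ (welfare_nonneg hG _)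
  suffices h : G.welfare o ≤ G.welfare (a G.n) + ∑ i : Fin G.n, ∑ r ∈ o i,
      (G.welfareRule r (G.load (a G.n) r + 1) - G.welfareRule r (G.load (a G.n) r)) by linarith
  have hswap : ∑ i : Fin G.n, ∑ r ∈ o i,
      (G.welfareRule r (G.load (a G.n) r + 1) - G.welfareRule r (G.load (a G.n) r)) =
      ∑ r, (G.load o r : ℝ) *
        (G.welfareRule r (G.load (a G.n) r + 1) - G.welfareRule r (G.load (a G.n) r)) := by
    simp only [AllocationGame.load, Finset.card_filter, Nat.cast_sum, Finset.sum_mul]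
    rw [Finset.sum_comm]
    refine Finset.sum_congr rfl fun i _ => ?_
    simp
  rw [hswap, welfare_eq_sum hG, welfare_eq_sum hG, ← Finset.sum_add_distrib]
  exact Finset.sum_le_sum fun r _ => submodularRules.le_add_mul_increment (hG.1 r).1 _ _

/-- The marginal contribution design. -/
noncomputable def marginalContribution : UtilityDesign submodularRules
  | _, 0 => 0
  | w, j + 1 => ⟨(w : ℕ → ℝ) (j + 1) - (w : ℕ → ℝ) j, sub_nonneg.2 (w.2.2.2.1 j)⟩

theorem marginalContribution_isNonincreasing : marginalContribution.IsNonincreasing := by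
  intro w j hj
  obtain ⟨j, rfl⟩ := Nat.exists_eq_add_of_le' hj
  exact w.2.2.2.2 j

theorem efficiency_marginalContribution_ge : 1 / 2 ≤ marginalContribution.efficiency 1 :=
  le_efficiency _ two_pos fun _ hG _ hb _ ho => welfare_le_two_mul_of_walk hG (fun _ _ => rfl) hb ho

/-! ### Bad instances built from coverage rules. -/

section upperBounds

variable (F : UtilityDesign submodularRules)

/-- The agents share all but one of `j + 1` resources, and could instead use that resource and
a private one. -/
theorem priceOfAnarchy_mul_le_of_cyclic {v : ℝ} (hv : 0 < v) (j N M : ℕ) (hj : 1 ≤ j)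
    (h : M * (F (coverageRule v hv) 1 : ℝ) ≤
      N * (j * F (coverageRule v hv) j - F (coverageRule v hv) (j + 1))) :
    F.priceOfAnarchy * (N + M) ≤ N := by
  have key := F.priceOfAnarchy_mul_le_of_equilibrium (n := j + 1)
    (X := Fin (j + 1) ⊕ Fin (j + 1)) (Sum.elim (fun _ => N) fun _ => M)
    (fun _ => coverageRule v hv)
    (fun k => (Finset.univ.erase k).map ⟨Sum.inl, Sum.inl_injective⟩)
    (fun k => {Sum.inl k, Sum.inr k}) ?_
  · have hc : ∀ x : Fin (j + 1), (Finset.univ.filter fun k => ¬ x = k).card = j := fun x => by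
      rw [Finset.filter_not, Finset.filter_eq]
      simp [Finset.card_sdiff]
    simp only [Finset.mem_insert, Finset.mem_singleton, coverageRule_apply,
      Fintype.sum_sum_type, Finset.mem_map, Finset.mem_erase, Finset.mem_univ, and_true,
      Function.Embedding.coeFn_mk, Sum.inl.injEq, Sum.inr.injEq, reduceCtorEq, or_false, false_or,
      exists_eq_right, and_false, exists_false, Finset.filter_false, Finset.card_empty, if_true,
      Sum.elim_inl, Sum.elim_inr, hc, Finset.filter_eq, ne_eq, Finset.card_singleton, one_ne_zero,
      if_false, mul_zero, Finset.sum_const, Finset.card_univ, Fintype.card_fin, nsmul_eq_mul,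
      if_neg (Nat.one_le_iff_ne_zero.1 hj), add_zero] at key
    have hpos : (0 : ℝ) < (j + 1 : ℕ) * v := by positivity
    refine le_of_mul_le_mul_right ?_ hpos
    linarith
  · intro i
    have hc : ∀ x : Fin (j + 1), x ≠ i →
        (Finset.univ.filter fun k => ¬ k = i ∧ ¬ x = k).card + 1 = j := fun x hx => by
      have : (Finset.univ.filter fun k => ¬ k = i ∧ ¬ x = k) = (Finset.univ.erase x).erase i := by
        ext k; simp [eq_comm]
      rw [this, Finset.card_erase_of_mem (by simp [hx.symm]),
        Finset.card_erase_of_mem (Finset.mem_univ _)]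
      simp
      omega
    have hc' : (Finset.univ.filter fun k : Fin (j + 1) => ¬ k = i ∧ ¬ i = k).card = j := by
      have : (Finset.univ.filter fun k => ¬ k = i ∧ ¬ i = k) = Finset.univ.erase i := by
        ext k; simp [eq_comm]
      rw [this, Finset.card_erase_of_mem (Finset.mem_univ _)]
      simp
    rw [Finset.sum_insert (by simp), Finset.sum_singleton, Finset.sum_map]
    simp only [Finset.mem_map, Finset.mem_erase, Finset.mem_univ, and_true,
      Function.Embedding.coeFn_mk, Sum.inl.injEq, reduceCtorEq,
      exists_eq_right, and_false, exists_false, Finset.filter_false, Finset.card_empty,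
      Sum.elim_inl, Sum.elim_inr, ne_eq, hc', zero_add]
    rw [Finset.sum_congr rfl fun x hx => by rw [hc x (Finset.ne_of_mem_erase hx)]]
    simp only [Finset.sum_const, Finset.card_erase_of_mem (Finset.mem_univ i), Finset.card_univ,
      Fintype.card_fin, Nat.add_sub_cancel, nsmul_eq_mul]
    linarith

/-- All agents share a resource, and could instead use a private one. -/
theorem priceOfAnarchy_mul_le_of_stack {v : ℝ} (hv : 0 < v) (j : ℕ) (hj : 1 ≤ j)
    (h : F (coverageRule v hv) 1 ≤ F (coverageRule v hv) j) :
    F.priceOfAnarchy * j ≤ 1 := by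
  have key := F.priceOfAnarchy_mul_le_of_equilibrium (n := j)
    (X := Option (Fin j)) (fun _ => 1) (fun _ => coverageRule v hv)
    (fun _ => {none}) (fun k => {some k}) ?_
  · simp only [coverageRule_apply, Fintype.sum_option, Finset.mem_singleton, reduceCtorEq,
      Finset.filter_false, Finset.card_empty, if_true, Option.some.injEq, Finset.filter_eq,
      Finset.mem_univ, Finset.card_singleton, one_ne_zero, if_false, Finset.filter_true,
      Finset.card_univ, Fintype.card_fin, if_neg (Nat.one_le_iff_ne_zero.1 hj), mul_zero,
      Finset.sum_const, nsmul_eq_mul, add_zero, zero_add, Nat.cast_one, one_mul] at key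
    refine le_of_mul_le_mul_right ?_ hv
    linarith
  · intro i
    simp only [Finset.sum_singleton, Finset.mem_singleton, reduceCtorEq, and_false,
      Finset.filter_false, Finset.card_empty, zero_add, and_true, Finset.filter_ne',
      Finset.card_erase_of_mem (Finset.mem_univ i), Finset.card_univ, Fintype.card_fin,
      Nat.sub_add_cancel hj, Nat.cast_one, one_mul]
    exact_mod_cast h

/-- A lone agent who earns nothing from the resource may stay idle at welfare 0. Hence the sole-user
utility can later serve as a unit to divide by. -/
theorem priceOfAnarchy_nonpos {v : ℝ} (hv : 0 < v) (h : F (coverageRule v hv) 1 = 0) :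
    F.priceOfAnarchy ≤ 0 := by
  have key := F.priceOfAnarchy_mul_le_of_equilibrium (n := 1)
    (X := Unit) (fun _ => 1) (fun _ => coverageRule v hv) (fun _ => ∅) (fun _ => {()}) (by simp [h])
  simp [coverageRule_apply] at key
  nlinarith

theorem efficiency_nonpos {v : ℝ} (hv : 0 < v) (h : F (coverageRule v hv) 1 = 0) :
    F.efficiency 1 ≤ 0 := by
  have key := F.efficiency_mul_le_of_sequential (n := 1)
    (X := Unit) (fun _ => 1) (fun _ => coverageRule v hv) (fun _ => ∅) (fun _ => {()}) (by simp [h])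
  simp [coverageRule_apply] at key
  nlinarith

/-- The agents pile up on the same resource, and could instead use a private one. -/
theorem efficiency_mul_le_of_stack {v : ℝ} (hv : 0 < v) (n N : ℕ) (M : Fin n → ℕ)
    (h : ∀ k, M k * (F (coverageRule v hv) 1 : ℝ) ≤ N * F (coverageRule v hv) (k + 1)) :
    F.efficiency 1 * ∑ k, (M k : ℝ) ≤ N := by
  have key := F.efficiency_mul_le_of_sequential (n := n)
    (X := Option (Fin n)) (fun x => x.elim N M) (fun _ => coverageRule v hv)
    (fun _ => {none}) (fun k => {some k}) ?_
  · simp only [coverageRule_apply, Fintype.sum_option, Finset.mem_singleton, reduceCtorEq,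
      Finset.filter_false, Finset.card_empty, if_true, Option.some.injEq, Finset.filter_eq,
      Finset.mem_univ, Finset.card_singleton, one_ne_zero, if_false, Finset.filter_true,
      Finset.card_univ, Fintype.card_fin, mul_zero, Option.elim_none, Option.elim_some,
      Finset.sum_const_zero, add_zero, zero_add, ← Finset.sum_mul] at key
    refine le_of_mul_le_mul_right ?_ hv
    rw [mul_assoc]
    refine key.trans ?_
    split_ifs
    · simpa using by positivity
    · rfl
  · intro i
    simpa only [Finset.sum_singleton, Finset.mem_singleton, reduceCtorEq, and_false,
      Finset.filter_false, Finset.card_empty, zero_add, and_true, Finset.filter_gt_eq_Iio,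
      Fin.card_Iio, Option.elim_none, Option.elim_some] using h i

/-- The first of two agents makes the same choice that the second agent is forced to make. -/
theorem efficiency_mul_le_of_collision {v v' : ℝ} (hv : 0 < v) (hv' : 0 < v') (N M : ℕ)
    (h : M * (F (coverageRule v' hv') 1 : ℝ) ≤ N * F (coverageRule v hv) 1) :
    F.efficiency 1 * (N * v + M * v') ≤ N * v := by
  have key := F.efficiency_mul_le_of_sequential (n := 2)
    (X := Bool) (fun x => if x then N else M)
    (fun x => if x then coverageRule v hv else coverageRule v' hv')
    (fun _ => {true}) ![{false}, {true}] ?_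
  · have h1 : (Finset.univ.filter fun k : Fin 2 =>
        true ∈ (![{false}, {true}] : Fin 2 → Finset Bool) k).card = 1 := by decide
    have h2 : (Finset.univ.filter fun k : Fin 2 =>
        false ∈ (![{false}, {true}] : Fin 2 → Finset Bool) k).card = 1 := by decide
    rw [Fintype.sum_bool, Fintype.sum_bool, h1, h2] at key
    simpa [coverageRule_apply] using key
  · intro i
    fin_cases i
    · simpa using h
    · simp

end upperBounds
-- The bound 1 - 1/e and the efficiency of designs attaining it.
section optimalPriceOfAnarchy

variable (F : UtilityDesign submodularRules) {v : ℝ} (hv : 0 < v)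

theorem utility_pos_of_priceOfAnarchy_pos (hC : 0 < F.priceOfAnarchy) :
    (0 : ℝ) < F (coverageRule v hv) 1 := by
  refine NNReal.coe_pos.2 (pos_iff_ne_zero.2 fun h => ?_)
  exact (F.priceOfAnarchy_nonpos hv h).not_gt hC

theorem utility_succ_ge (hC : 0 < F.priceOfAnarchy) {χ : ℝ} (hχ : 0 ≤ χ)
    (hCχ : 1 ≤ F.priceOfAnarchy * (1 + χ)) {j : ℕ} (hj : 1 ≤ j) :
    j * (F (coverageRule v hv) j : ℝ) - χ * F (coverageRule v hv) 1 ≤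
      F (coverageRule v hv) (j + 1) := by
  have hf := F.utility_pos_of_priceOfAnarchy_pos hv hC
  by_contra! hlt
  obtain ⟨y, hy⟩ : ∃ y, y * (F (coverageRule v hv) 1 : ℝ) =
      j * F (coverageRule v hv) j - F (coverageRule v hv) (j + 1) :=
    ⟨_, div_mul_cancel₀ _ hf.ne'⟩
  have hχy : χ < y := by
    refine lt_of_mul_lt_mul_right ?_ hf.le
    linarith
  have hpos : 0 < F.priceOfAnarchy * (1 + y) - 1 := by nlinarith
  -- The weight ratio `y` is approximated by `⌊N * y⌋₊ / N`; this `N` is large enough for the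
  -- rounding loss not to hide the contradiction.
  obtain ⟨N, hN⟩ := exists_nat_gt (F.priceOfAnarchy / (F.priceOfAnarchy * (1 + y) - 1))
  rw [div_lt_iff₀ hpos] at hN
  have hNy : 0 ≤ N * y := mul_nonneg (Nat.cast_nonneg _) (hχ.trans hχy.le)
  have key := F.priceOfAnarchy_mul_le_of_cyclic hv j N ⌊N * y⌋₊ hj (by
    rw [← hy, ← mul_assoc]
    exact mul_le_mul_of_nonneg_right (Nat.floor_le hNy) hf.le)
  have hfl := mul_lt_mul_of_pos_left (Nat.lt_floor_add_one (N * y)) hC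
  linarith

/-- Dividing the recursion of `utility_succ_ge` by j! makes it telescope. -/
theorem utility_succ_ge_factorial (hC : 0 < F.priceOfAnarchy) {χ : ℝ} (hχ : 0 ≤ χ)
    (hCχ : 1 ≤ F.priceOfAnarchy * (1 + χ)) (j : ℕ) :
    j.factorial * (F (coverageRule v hv) 1 : ℝ) *
      (1 - χ * ∑ i ∈ Finset.range j, 1 / ((i + 1).factorial : ℝ)) ≤
        F (coverageRule v hv) (j + 1) := by
  induction j with
  | zero => simp
  | succ j ih =>
    refine le_trans ?_ (F.utility_succ_ge hv hC hχ hCχ (Nat.le_add_left 1 j))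
    have h := mul_le_mul_of_nonneg_left ih (Nat.cast_nonneg (α := ℝ) (j + 1))
    have hfac : ((j + 1).factorial : ℝ) * (1 / (j + 1).factorial) = 1 :=
      mul_one_div_cancel (Nat.cast_ne_zero.2 (Nat.factorial_ne_zero _))
    have hsucc : ((j + 1).factorial : ℝ) = (j + 1 : ℕ) * j.factorial := by
      rw [Nat.factorial_succ, Nat.cast_mul]
    rw [Finset.sum_range_succ]
    refine le_trans (le_of_eq ?_) (sub_le_sub_right h _)
    linear_combination (-χ * F (coverageRule v hv) 1) * hfac +
      (F (coverageRule v hv) 1 * (1 - χ * ∑ i ∈ Finset.range j, 1 / ((i + 1).factorial : ℝ))) *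
        hsucc

theorem sum_one_div_factorial_le (j : ℕ) :
    ∑ i ∈ Finset.range j, 1 / ((i + 1).factorial : ℝ) ≤ Real.exp 1 - 1 := by
  have h := Real.sum_le_exp_of_nonneg zero_le_one (j + 1)
  rw [Finset.sum_range_succ'] at h
  simp only [one_pow, Nat.factorial_zero, Nat.cast_one, div_one] at h
  linarith

theorem priceOfAnarchy_le : F.priceOfAnarchy ≤ 1 - 1 / Real.exp 1 := by
  by_contra! hlt
  have he := Real.exp_pos 1
  have he1 := exp_one_sub_one_pos
  have hbase : 0 < 1 - 1 / Real.exp 1 := by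
    rw [one_sub_div he.ne']; positivity
  have hC := hbase.trans hlt
  obtain ⟨χ, hχ, hCχ, hδ⟩ : ∃ χ, 0 ≤ χ ∧ 1 ≤ F.priceOfAnarchy * (1 + χ) ∧
      0 < 1 - χ * (Real.exp 1 - 1) := by
    -- The maximum with 0 avoids having to show that the price of anarchy is at most 1.
    refine ⟨max 0 (1 / F.priceOfAnarchy - 1), le_max_left _ _, ?_, ?_⟩
    · calc 1 = F.priceOfAnarchy * (1 + (1 / F.priceOfAnarchy - 1)) := by field_simp; ring
        _ ≤ _ := mul_le_mul_of_nonneg_left (by gcongr; exact le_max_right _ _) hC.le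
    · rw [sub_pos, ← lt_div_iff₀ he1]
      refine max_lt (by positivity) ?_
      have : 1 / F.priceOfAnarchy < 1 / (1 - 1 / Real.exp 1) :=
        one_div_lt_one_div_of_lt hbase hlt
      refine (sub_lt_sub_right this 1).trans_eq ?_
      field_simp
      ring
  have hf := F.utility_pos_of_priceOfAnarchy_pos one_pos hC
  -- The first bound, with j ≤ j!, lifts the utility at `j + 1` to that of a sole user; the second
  -- contradicts the crowded equilibrium.
  obtain ⟨j, hj⟩ := exists_nat_gt (max (1 / (1 - χ * (Real.exp 1 - 1))) (1 / F.priceOfAnarchy))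
  rw [max_lt_iff, div_lt_iff₀ hδ, div_lt_iff₀ hC] at hj
  have key := F.priceOfAnarchy_mul_le_of_stack one_pos (j + 1) (Nat.le_add_left _ _) (by
    rw [← NNReal.coe_le_coe]
    refine le_trans ?_ (F.utility_succ_ge_factorial one_pos hC hχ hCχ j)
    have h1 : 1 - χ * (Real.exp 1 - 1) ≤
        1 - χ * ∑ i ∈ Finset.range j, 1 / ((i + 1).factorial : ℝ) := by
      gcongr
      exact sum_one_div_factorial_le j
    have h2 : (j : ℝ) ≤ j.factorial := mod_cast j.self_le_factorial
    have h3 := mul_le_mul h2 h1 hδ.le (Nat.cast_nonneg _)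
    rw [mul_right_comm]
    exact le_mul_of_one_le_left hf.le (hj.1.le.trans h3))
  push_cast at key
  linarith [hj.2]

/-- With χ = 1/(e-1) the factor in `utility_succ_ge_factorial` is a tail of the exponential series
over e-1, at least 1/(2 (j+1)!) since e-1 < 2. -/
theorem utility_succ_ge_of_optimal (hC : F.priceOfAnarchy = 1 - 1 / Real.exp 1) (j : ℕ) :
    (F (coverageRule v hv) 1 : ℝ) ≤ 2 * (j + 1) * F (coverageRule v hv) (j + 1) := by
  have he := Real.exp_pos 1
  have he1 := exp_one_sub_one_pos
  have hbase : 0 < 1 - 1 / Real.exp 1 := by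
    rw [one_sub_div he.ne']; positivity
  have h := F.utility_succ_ge_factorial hv (hC ▸ hbase) (χ := 1 / (Real.exp 1 - 1))
    (by positivity) (by rw [hC]; field_simp; linarith) j
  have hS := sum_one_div_factorial_le (j + 1)
  rw [Finset.sum_range_succ] at hS
  set S := ∑ i ∈ Finset.range j, 1 / ((i + 1).factorial : ℝ)
  have hχ : 1 / 2 ≤ 1 / (Real.exp 1 - 1) := by
    have := Real.exp_one_lt_d9
    exact one_div_le_one_div_of_le he1 (by linarith)
  have hrest : 1 / 2 * (1 / ((j + 1).factorial : ℝ)) ≤ 1 - 1 / (Real.exp 1 - 1) * S := by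
    calc _ ≤ 1 / (Real.exp 1 - 1) * (Real.exp 1 - 1 - S) :=
          mul_le_mul hχ (by linarith) (by positivity) (by positivity)
      _ = _ := by field_simp
  have hf : 0 ≤ (j.factorial : ℝ) * F (coverageRule v hv) 1 := by positivity
  have h2 := mul_le_mul_of_nonneg_left ((mul_le_mul_of_nonneg_left hrest hf).trans h)
    (by positivity : (0 : ℝ) ≤ 2 * (j + 1))
  refine le_trans (le_of_eq ?_) h2
  rw [Nat.factorial_succ]
  have : (j.factorial : ℝ) ≠ 0 := Nat.cast_ne_zero.2 j.factorial_ne_zero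
  push_cast
  field_simp

theorem efficiency_eq_zero_of_optimal (hC : F.priceOfAnarchy = 1 - 1 / Real.exp 1) :
    F.efficiency 1 = 0 := by
  refine le_antisymm ?_ (F.efficiency_nonneg 1)
  by_contra! hpos
  have hH : ∀ n : ℕ, F.efficiency 1 * ∑ k ∈ Finset.range n, 1 / ((k : ℝ) + 1) ≤ 2 := by
    intro n
    have hM : ∀ k : Fin n, ((n.factorial / (k + 1 : ℕ) : ℕ) : ℝ) =
        n.factorial * (1 / ((k : ℕ) + 1)) := fun k => by
      rw [Nat.cast_div (Nat.dvd_factorial (Nat.succ_pos _) k.2) (by positivity)]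
      push_cast
      ring
    -- Private weights 1/(k+1) against a common weight 2, scaled by n! to become integers.
    have key := F.efficiency_mul_le_of_stack one_pos n (2 * n.factorial)
      (fun k => n.factorial / (k + 1)) fun k => by
        rw [hM]
        have h := F.utility_succ_ge_of_optimal one_pos hC k
        push_cast
        calc _ ≤ n.factorial * (1 / ((k : ℕ) + 1)) *
              (2 * ((k : ℕ) + 1) * (F (coverageRule 1 one_pos) (k + 1) : ℝ)) := by gcongr
          _ = _ := by field_simp
    simp only [hM] at key
    rw [← Finset.mul_sum, Fin.sum_univ_eq_sum_range (fun k => 1 / ((k : ℝ) + 1)) n] at key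
    push_cast at key
    refine le_of_mul_le_mul_right ?_ (Nat.cast_pos.2 n.factorial_pos : (0 : ℝ) < _)
    linarith
  obtain ⟨n, hn⟩ := (Real.tendsto_sum_range_one_div_nat_succ_atTop.eventually_gt_atTop
    (2 / F.efficiency 1)).exists
  rw [div_lt_iff₀' hpos] at hn
  exact (hH n).not_gt hn

end optimalPriceOfAnarchy

/-! ### Designs with one-round efficiency 1/2. -/

theorem card_filter_eq_sub {n : ℕ} (P : Fin n → Prop) [DecidablePred P] (p q : ℕ)
    (h : ∀ k : Fin n, P k ↔ p ≤ k ∧ (k : ℕ) < q) (hq : q ≤ n) :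
    (Finset.univ.filter P).card = q - p := by
  rw [← Nat.card_Ico, ← Finset.card_map Fin.valEmbedding]
  congr 1
  ext x
  simp only [Finset.mem_map, Finset.mem_filter, Finset.mem_univ, true_and, Fin.valEmbedding_apply,
    Finset.mem_Ico, h]
  exact ⟨fun ⟨k, hk, hx⟩ => hx ▸ hk, fun hx => ⟨⟨x, by omega⟩, hx, rfl⟩⟩

section optimalEfficiency

variable (F : UtilityDesign submodularRules)

theorem efficiency_le : F.efficiency 1 ≤ 1 / 2 := by
  have h := F.efficiency_mul_le_of_collision one_pos one_pos 1 1 le_rfl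
  norm_num at h
  linarith

variable {F}

theorem utility_pos_of_efficiency (hF : 1 / 2 ≤ F.efficiency 1) {v : ℝ} (hv : 0 < v) : (0 : ℝ) < F (coverageRule v hv) 1 := by
  refine NNReal.coe_pos.2 (pos_iff_ne_zero.2 fun h => ?_)
  have := F.efficiency_nonpos hv h
  linarith

/-- Otherwise, for a rational M/N strictly between the value ratio v/v' and the utility ratio, the
first agent of the collision game prefers `N` copies of value `v` to `M` copies of larger total
value, and less than half the optimum remains. -/
theorem utility_mul_le (hF : 1 / 2 ≤ F.efficiency 1) {v v' : ℝ} (hv : 0 < v) (hv' : 0 < v') :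
    F (coverageRule v hv) 1 * v' ≤ F (coverageRule v' hv') 1 * v := by
  by_contra! hlt
  have hg := utility_pos_of_efficiency hF hv'
  obtain ⟨q, hq1, hq2⟩ := exists_rat_btwn (show v / v' <
      (F (coverageRule v hv) 1 : ℝ) / F (coverageRule v' hv') 1 by
    rw [div_lt_div_iff₀ hv' hg]; linarith)
  have hq0 : 0 < q := by
    have : (0 : ℝ) < q := (div_pos hv hv').trans hq1
    exact_mod_cast this
  obtain ⟨M, hM⟩ := Int.eq_ofNat_of_zero_le (Rat.num_nonneg.2 hq0.le)
  have hden : (0 : ℝ) < q.den := Nat.cast_pos.2 q.den_pos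
  have hqM : (q : ℝ) = M / q.den := by
    rw [Rat.cast_def, hM]; rfl
  rw [hqM] at hq1 hq2
  rw [div_lt_div_iff₀ hden hg] at hq2
  rw [div_lt_div_iff₀ hv' hden] at hq1
  have key := F.efficiency_mul_le_of_collision hv hv' q.den M (by linarith)
  have : (0 : ℝ) ≤ q.den * v + M * v' := by positivity
  nlinarith

theorem utility_eq_mul (hF : 1 / 2 ≤ F.efficiency 1) {v : ℝ} (hv : 0 < v) :
    (F (coverageRule v hv) 1 : ℝ) = F (coverageRule 1 one_pos) 1 * v := by
  have h1 := utility_mul_le hF hv one_pos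
  have h2 := utility_mul_le hF one_pos hv
  linarith

/-- First `a + b` agents use a common resource, `a` of which could use a private one; then `c`
agents prefer a private resource to the common one; the last agent uses their private
resources. -/
theorem efficiency_mul_le_of_mixed {κ : ℝ} (hκ : 0 < κ)
    (hscale : ∀ v (hv : 0 < v), (F (coverageRule v hv) 1 : ℝ) = κ * v)
    (w : submodularRules) (a b c : ℕ) :
    F.efficiency 1 * ((w : ℕ → ℝ) (b + c) + ∑ i ∈ Finset.range a, F w (i + 1) / κ +
        c * (F w (a + b + 1) / κ)) ≤
      (w : ℕ → ℝ) (a + b) + c * (F w (a + b + 1) / κ) := by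
  obtain ⟨m, hm⟩ : ∃ m, m = a + b + c := ⟨_, rfl⟩
  -- Division by `κ` makes each private resource tie with the common one at the moment its owner
  -- moves.
  let V : ℕ → ℝ := fun k => if k < a then F w (k + 1) / κ else F w (a + b + 1) / κ
  have hV : ∀ k, 0 ≤ V k := fun k => by
    simp only [V]; split_ifs <;> positivity
  let μ : Option (Fin m) → ℕ := fun x => x.elim 1 fun k => if 0 < V k then 1 else 0
  let ρ : Option (Fin m) → submodularRules := fun x => x.elim w fun k =>
    if h : 0 < V k then coverageRule (V k) h else coverageRule 1 one_pos
  have hμF : ∀ k : Fin m, μ (some k) * (F (ρ (some k)) 1 : ℝ) = κ * V k := by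
    intro k
    by_cases h : 0 < V k
    · simp [μ, ρ, h, hscale]
    · simp [μ, ρ, le_antisymm (not_lt.1 h) (hV k)]
  have hμρ : ∀ (k : Fin m) j, μ (some k) * (ρ (some k) : ℕ → ℝ) j = if j = 0 then 0 else V k := by
    intro k j
    by_cases h : 0 < V k
    · simp [μ, ρ, h, coverageRule_apply]
    · simp [μ, ρ, le_antisymm (not_lt.1 h) (hV k)]
  -- The forced choice of the last agent: it keeps the private resources of the `c` agents covered
  -- in the optimum too, when their owners use the common resource.
  let T : Finset (Option (Fin m)) :=
    (Finset.univ.filter fun k : Fin m => a + b ≤ (k : ℕ)).map Function.Embedding.some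
  let β : Fin (m + 1) → Finset (Option (Fin m)) := fun k =>
    if (k : ℕ) < a + b then {none} else if h : (k : ℕ) < m then {some ⟨k, h⟩} else T
  let ω : Fin (m + 1) → Finset (Option (Fin m)) := fun k =>
    if h : (k : ℕ) < a then {some ⟨k, by omega⟩} else if (k : ℕ) < m then {none} else T
  have hβn : ∀ k, none ∈ β k ↔ (k : ℕ) < a + b := by
    intro k
    simp only [β, T]
    split_ifs with h1 h2 <;> simp [h1]
  have hβs : ∀ k (l : Fin m), some l ∈ β k ↔ a + b ≤ (l : ℕ) ∧ ((k : ℕ) = l ∨ (k : ℕ) = m) := by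
    intro k l
    have := k.2
    have := l.2
    simp only [β, T]
    split_ifs with h1 h2 <;> simp [Fin.ext_iff] <;> grind
  have hωn : ∀ k, none ∈ ω k ↔ a ≤ (k : ℕ) ∧ (k : ℕ) < m := by
    intro k
    simp only [ω, T]
    split_ifs with h1 h2 <;> simp <;> omega
  have hωs : ∀ k (l : Fin m), some l ∈ ω k ↔ (l : ℕ) < a ∧ (k : ℕ) = l ∨
      a + b ≤ (l : ℕ) ∧ (k : ℕ) = m := by
    intro k l
    have := k.2
    have := l.2
    simp only [ω, T]
    split_ifs with h1 h2 <;> simp [Fin.ext_iff] <;> grind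
  have key := F.efficiency_mul_le_of_sequential μ ρ β ω ?_
  · have hload : ∀ (A : Fin (m + 1) → Finset (Option (Fin m))) (P : ℕ → Prop) [DecidablePred P],
        (∀ l : Fin m, P l ↔ ∃ k, some l ∈ A k) →
        ∑ k : Fin m, (μ (some k) : ℝ) * (ρ (some k) : ℕ → ℝ)
          (Finset.univ.filter fun i => some k ∈ A i).card =
          ∑ k ∈ Finset.range m, if P k then V k else 0 := by
      intro A P _ hP
      rw [← Fin.sum_univ_eq_sum_range (fun k => if P k then V k else 0) m]
      refine Finset.sum_congr rfl fun k _ => ?_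
      rw [hμρ]
      simp only [Finset.card_eq_zero, Finset.filter_eq_empty_iff, Finset.mem_univ, true_imp_iff,
        hP]
      by_cases h : ∃ i, some k ∈ A i
      · have h' : ¬ ∀ i, some k ∉ A i := by simpa using h
        simp [h]
      · simp [h]
    rw [Fintype.sum_option, Fintype.sum_option,
      hload ω (fun l => l < a ∨ a + b ≤ l) fun l => ?_, hload β (fun l => a + b ≤ l) fun l => ?_,
      card_filter_eq_sub _ a m hωn (by omega),
      card_filter_eq_sub _ 0 (a + b) (fun k => by simpa using hβn k) (by omega),
      show m - a = b + c by omega, show a + b - 0 = a + b by omega,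
      show Finset.range m = Finset.range (a + b + c) by rw [hm],
      Finset.sum_range_add, Finset.sum_range_add, Finset.sum_range_add, Finset.sum_range_add] at key
    · have e1 : ∀ f : ℕ → ℝ, (∀ i < b, f (a + i) = 0) → ∑ i ∈ Finset.range b, f (a + i) = 0 :=
        fun f hf => Finset.sum_eq_zero fun i hi => hf i (Finset.mem_range.1 hi)
      have e2 : ∀ f : ℕ → ℝ, (∀ i, f (a + b + i) = F w (a + b + 1) / κ) →
          ∑ i ∈ Finset.range c, f (a + b + i) = c * (F w (a + b + 1) / κ) := fun f hf => by
        simp [hf]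
      have e3 : ∑ i ∈ Finset.range a, (if i < a ∨ a + b ≤ i then V i else 0) =
          ∑ i ∈ Finset.range a, F w (i + 1) / κ := Finset.sum_congr rfl fun i hi => by
        simp [V, Finset.mem_range.1 hi]
      have e4 : ∑ i ∈ Finset.range a, (if a + b ≤ i then V i else 0) = 0 :=
        Finset.sum_eq_zero fun i hi => if_neg (by have := Finset.mem_range.1 hi; omega)
      have hVc : ∀ i, V (a + b + i) = F w (a + b + 1) / κ := fun i => if_neg (by omega)
      rw [e1 (fun l => if l < a ∨ a + b ≤ l then V l else 0) fun i hi => if_neg (by omega),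
        e1 (fun l => if a + b ≤ l then V l else 0) fun i hi => if_neg (by omega),
        e2 (fun l => if l < a ∨ a + b ≤ l then V l else 0) fun i => by
          rw [if_pos (Or.inr (Nat.le_add_right _ _)), hVc],
        e2 (fun l => if a + b ≤ l then V l else 0) fun i => by
          rw [if_pos (Nat.le_add_right _ _), hVc], e3, e4] at key
      simpa [μ, ρ, add_assoc] using key
    · exact ⟨fun h => ⟨Fin.last m, (hβs _ _).2 ⟨h, Or.inr rfl⟩⟩,
        fun ⟨k, hk⟩ => ((hβs _ _).1 hk).1⟩
    · constructor
      · rintro (h | h)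
        · exact ⟨l.castSucc, (hωs _ _).2 (Or.inl ⟨h, rfl⟩)⟩
        · exact ⟨Fin.last m, (hωs _ _).2 (Or.inr ⟨h, rfl⟩)⟩
      · rintro ⟨k, hk⟩
        rcases (hωs _ _).1 hk with h | h
        · exact Or.inl h.1
        · exact Or.inr h.1
  · intro i
    have hprivate : ∀ l : Fin m, (i : ℕ) = l →
        (Finset.univ.filter fun k => k < i ∧ some l ∈ β k).card = 0 := by
      intro l hl
      rw [Finset.card_eq_zero, Finset.filter_eq_empty_iff]
      rintro k - ⟨hki, hk⟩
      have := (hβs _ _).1 hk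
      have := l.2
      rw [Fin.lt_def] at hki
      omega
    have hcommon : (Finset.univ.filter fun k => k < i ∧ none ∈ β k).card = min (i : ℕ) (a + b) :=
      card_filter_eq_sub (fun k : Fin (m + 1) => k < i ∧ none ∈ β k) 0 (min (i : ℕ) (a + b))
        (fun k => by rw [hβn, Fin.lt_def]; omega) (by omega)
    by_cases h1 : (i : ℕ) < a
    · have hω : ω i = {some ⟨i, by omega⟩} := dif_pos h1
      have hβ : β i = {none} := if_pos (by omega)
      rw [hω, hβ, Finset.sum_singleton, Finset.sum_singleton, hprivate ⟨i, by omega⟩ rfl, hcommon,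
        zero_add, hμF, min_eq_left (by omega)]
      simp [μ, ρ, V, h1, mul_div_cancel₀ _ hκ.ne']
    by_cases h2 : (i : ℕ) < a + b
    · have hω : ω i = {none} := by simp only [ω]; rw [dif_neg h1, if_pos (by omega)]
      have hβ : β i = {none} := if_pos h2
      rw [hω, hβ]
    by_cases h3 : (i : ℕ) < m
    · have hω : ω i = {none} := by simp only [ω]; rw [dif_neg h1, if_pos h3]
      have hβ : β i = {some ⟨i, h3⟩} := by simp only [β]; rw [if_neg h2, dif_pos h3]
      rw [hω, hβ, Finset.sum_singleton, Finset.sum_singleton, hprivate ⟨i, h3⟩ rfl, hcommon,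
        zero_add, hμF, min_eq_right (by omega)]
      simp [μ, ρ, V, h1, mul_div_cancel₀ _ hκ.ne']
    · have hω : ω i = T := by simp only [ω]; rw [dif_neg h1, if_neg h3]
      have hβ : β i = T := by simp only [β]; rw [if_neg h2, dif_neg h3]
      rw [hω, hβ]

/-- This is the smoothness inequality with constant 2, except that a sum of earlier utilities
replaces `a * F w (a + b)`; for nonincreasing utilities the sum is the larger of the two. -/
theorem le_of_efficiency (hF : 1 / 2 ≤ F.efficiency 1) (w : submodularRules) (a b c : ℕ) :
    (w : ℕ → ℝ) (b + c) + 1 / F (coverageRule 1 one_pos) 1 *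
      (∑ i ∈ Finset.range a, F w (i + 1) - c * F w (a + b + 1)) ≤ 2 * (w : ℕ → ℝ) (a + b) := by
  have hκ := utility_pos_of_efficiency hF one_pos
  have h := F.efficiency_mul_le_of_mixed hκ (fun v hv => utility_eq_mul hF hv) w a b c
  have hw := submodularRules.nonneg w.2 (b + c)
  rw [← Finset.sum_div] at h
  have h2 := (mul_le_mul_of_nonneg_right hF (by positivity)).trans h
  have e : ∀ x y : ℝ, 1 / (F (coverageRule 1 one_pos) 1 : ℝ) * (x - c * y) =
    x / F (coverageRule 1 one_pos) 1 - c * (y / F (coverageRule 1 one_pos) 1) := fun x y => by ring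
  push_cast
  rw [e]
  linarith

theorem priceOfAnarchy_ge_of_isNonincreasing (hF : 1 / 2 ≤ F.efficiency 1)
    (hmono : F.IsNonincreasing) : 1 / 2 ≤ F.priceOfAnarchy := by
  have hκ := utility_pos_of_efficiency hF one_pos
  refine le_priceOfAnarchy F two_pos (one_div_pos.2 hκ).le fun w a b c => ?_
  refine le_trans ?_ (le_of_efficiency hF w a b c)
  gcongr
  push_cast
  have hanti : ∀ i n, F w (i + 1 + n) ≤ F w (i + 1) := fun i n => by
    induction n with
    | zero => exact le_rfl
    | succ n ih => exact (hmono w (i + 1 + n) (by omega)).trans ih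
  calc (a : ℝ) * F w (a + b) = ∑ i ∈ Finset.range a, (F w (a + b) : ℝ) := by simp
    _ ≤ _ := Finset.sum_le_sum fun i hi => by
      have h := hanti i (a + b - (i + 1))
      have := Finset.mem_range.1 hi
      rw [Nat.add_sub_cancel' (by omega)] at h
      exact_mod_cast h

theorem utility_two_eq_zero (hF : 1 / 2 ≤ F.efficiency 1) :
    F (coverageRule 1 one_pos) 2 = 0 := by
  have hκ := utility_pos_of_efficiency hF one_pos
  -- Here both welfare values are 1, so the inequality reads 1 + (f(1) + f(2))/f(1) ≤ 2.
  have h := le_of_efficiency hF (coverageRule 1 one_pos) 2 1 0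
  simp only [coverageRule_apply, Finset.sum_range_succ, Finset.sum_range_zero] at h
  norm_num at h
  rw [mul_add, inv_mul_cancel₀ hκ.ne'] at h
  have h0 : ((F (coverageRule 1 one_pos) 1 : ℝ))⁻¹ * F (coverageRule 1 one_pos) 2 ≤ 0 := by linarith
  have h1 := nonpos_of_mul_nonpos_right h0 (inv_pos.2 hκ)
  exact le_antisymm (mod_cast h1) zero_le

/-- One agent occupies the only resource the other can use; since doubling up pays nothing, the
other idles, and half the optimum is lost. -/
theorem priceOfAnarchy_le_of_efficiency (hF : 1 / 2 ≤ F.efficiency 1) :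
    F.priceOfAnarchy ≤ 1 / 2 := by
  have key := F.priceOfAnarchy_mul_le_of_equilibrium (n := 2) (X := Bool) (fun _ => 1)
    (fun _ => coverageRule 1 one_pos) ![{true}, ∅] ![{false}, {true}] ?_
  · have h1 : (Finset.univ.filter fun k : Fin 2 =>
        true ∈ (![{false}, {true}] : Fin 2 → Finset Bool) k).card = 1 := by decide
    have h2 : (Finset.univ.filter fun k : Fin 2 =>
        false ∈ (![{false}, {true}] : Fin 2 → Finset Bool) k).card = 1 := by decide
    have h3 : (Finset.univ.filter fun k : Fin 2 =>
        true ∈ (![{true}, ∅] : Fin 2 → Finset Bool) k).card = 1 := by decide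
    have h4 : (Finset.univ.filter fun k : Fin 2 =>
        false ∈ (![{true}, ∅] : Fin 2 → Finset Bool) k).card = 0 := by decide
    rw [Fintype.sum_bool, Fintype.sum_bool, h1, h2, h3, h4] at key
    norm_num [coverageRule_apply] at key
    linarith
  · have h1 : (Finset.univ.filter fun k : Fin 2 =>
        k ≠ 0 ∧ false ∈ (![{true}, ∅] : Fin 2 → Finset Bool) k).card = 0 := by decide
    have h2 : (Finset.univ.filter fun k : Fin 2 =>
        k ≠ 0 ∧ true ∈ (![{true}, ∅] : Fin 2 → Finset Bool) k).card = 0 := by decide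
    have h3 : (Finset.univ.filter fun k : Fin 2 =>
        k ≠ 1 ∧ true ∈ (![{true}, ∅] : Fin 2 → Finset Bool) k).card = 1 := by decide
    rw [Fin.forall_fin_two]
    constructor
    · show ∑ x ∈ {false}, _ ≤ ∑ x ∈ {true}, _
      rw [Finset.sum_singleton, Finset.sum_singleton, h1, h2]
    · show ∑ x ∈ {true}, _ ≤ ∑ x ∈ ∅, _
      rw [Finset.sum_singleton, Finset.sum_empty, h3, utility_two_eq_zero hF]
      simp

end optimalEfficiency

end UtilityDesign

theorem theorem4 :
    (∃ F : UtilityDesign submodularRules, F.IsPoAOptimal) ∧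
    (∀ F : UtilityDesign submodularRules, F.IsPoAOptimal →
      F.efficiency 1 = 0 ∧ F.priceOfAnarchy = 1 - 1 / Real.exp 1) ∧
    (∃ F : UtilityDesign submodularRules, F.IsOneRoundOptimal ∧ F.IsNonincreasing) ∧
    (∀ F : UtilityDesign submodularRules, F.IsOneRoundOptimal →
      F.efficiency 1 = 1 / 2 ∧ F.priceOfAnarchy ≤ 1 / 2 ∧
      (F.IsNonincreasing → F.priceOfAnarchy = 1 / 2)) := by
  open UtilityDesign in
  obtain ⟨F₀, hF₀⟩ := exists_priceOfAnarchy_ge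
  refine ⟨⟨F₀, fun F => F.priceOfAnarchy_le.trans hF₀⟩, fun F hF => ?_,
    ⟨marginalContribution, fun F => F.efficiency_le.trans efficiency_marginalContribution_ge,
      marginalContribution_isNonincreasing⟩, fun F hF => ?_⟩
  · have h := le_antisymm F.priceOfAnarchy_le (hF₀.trans (hF F₀))
    exact ⟨F.efficiency_eq_zero_of_optimal h, h⟩
  · have h := efficiency_marginalContribution_ge.trans (hF marginalContribution)
    exact ⟨le_antisymm F.efficiency_le h, priceOfAnarchy_le_of_efficiency h, fun hmono =>
      le_antisymm (priceOfAnarchy_le_of_efficiency h) (priceOfAnarchy_ge_of_isNonincreasing h hmono)⟩
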